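/- Let $n\in\mathbb N=\{0,1,2,\dots\}$. For $\mu\in\mathbb C$ and $z\in\mathbb C\setminus[-1,1]$ let $$P_n^\mu(z)=\Big(\frac{z+1}{z-1}\Big)^{\mu/2}\sum_{k=0}^{n}\frac{(k+n)!}{k!\,(n-k)!\,\Gamma(k-\mu+1)}\Big(\frac{z-1}{2}\Big)^{k}$$ be Hobson's associated Legendre function of the first kind of degree $n$ and order $\mu$, where $1/\Gamma$ is the entire reciprocal Gamma function and the power and $\ln\frac{z+1}{z-1}$ are principal. Let $\psi=\Gamma'/\Gamma$. Then for all $\mu\in\mathbb C$ and $z\in\mathbb C\setminus[-1,1]$ the function $P_n^\mu(z)$ is complex differentiable with respect to $\mu$. Define $U_n^\mu(z)$ by $$\frac{\partial P_n^\mu(z)}{\partial\mu}=\frac12P_n^\mu(z)\ln\frac{z+1}{z-1}+U_n^\mu(z).$$ The following hold for all $z\in\mathbb C\setminus[-1,1]$. (a) If $\mu\notin\{1,2,3,\dots\}$ and $\mu\notin\{-n-1,-n-2,\dots\}$, then $$U_n^\mu(z)=\psi(n-\mu+1)P_n^\mu(z)+\sum_{k=0}^{n-1}(-1)^{k+n}\frac{2k+1}{(n-k)(k+n+1)}\left[1-(-1)^{k+n}\frac{\Gamma(n+\mu+1)\Gamma(k-\mu+1)}{\Gamma(n-\mu+1)\Gamma(k+\mu+1)}\right]P_k^\mu(z),$$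 with $1/\Gamma(k+\mu+1)=0$ at the poles of $\Gamma$. (b) If $\mu\notin\{n+1,n+2,\dots\}$ and $\mu\notin\{-n-1,-n-2,\dots\}$ (so in particular if $\mu$ is an integer with $|\mu|\le n$), then $$U_n^\mu(z)=\psi(n-\mu+1)P_n^\mu(z)+\sum_{k=0}^{n-1}(-1)^{k+n}\frac{2k+1}{(n-k)(k+n+1)}\left[P_k^\mu(z)-(-1)^{n}\frac{\Gamma(n+\mu+1)}{\Gamma(n-\mu+1)}P_k^{-\mu}(-z)\right].$$ (c) For every $\mu_0\in\mathbb C$, the right-hand sides of (a) and of (b) both tend to $U_n^{\mu_0}(z)$ as $\mu\to\mu_0$, $\mu\ne\mu_0$. In this sense both formulas hold for arbitrary complex order. (d) For every $\mu\in\mathbb C$, the functions $P_n^\mu$ and $U_n^\mu$ are holomorphic on $\mathbb C\setminus[-1,1]$, and $U_n^\mu$ satisfies there the inhomogeneous Legendre equation $$\left[\frac{\mathrm d}{\mathrm dz}(1-z^2)\frac{\mathrm d}{\mathrm dz}+n(n+1)-\frac{\mu^2}{1-z^2}\right]U_n^\mu(z)=-2\frac{\mathrm dP_n^\mu(z)}{\mathrm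 dz}+\frac{2\mu}{1-z^2}P_n^\mu(z).$$ -/

import Mathlib

open scoped Topology

noncomputable section

/-- The complex plane cut along the real segment `[-1, 1]`. -/
def cutPlane : Set ℂ := (Complex.ofReal '' Set.Icc (-1 : ℝ) 1)ᶜ

/-- Hobson's associated Legendre function of the first kind `P_n^μ(z)` of degree `n ∈ ℕ` and
arbitrary complex order `μ`, for `z` in the plane cut along `[-1, 1]`:
`((z+1)/(z-1))^(μ/2) ∑_{k=0}^n (k+n)! / (k! (n-k)! Γ(k-μ+1)) ((z-1)/2)^k`.
All powers are principal. Since `Γ` takes the value `0` at its poles in Mathlib, the factor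
`1 / Γ(k-μ+1)` is the entire function of `μ` it stands for, also where `k-μ+1` is a pole. -/
def assocLegendreP (n : ℕ) (μ z : ℂ) : ℂ :=
  ((z + 1) / (z - 1)) ^ (μ / 2) *
    ∑ k ∈ Finset.range (n + 1),
      ((k + n).factorial : ℂ) /
        ((k.factorial : ℂ) * ((n - k).factorial : ℂ) * Complex.Gamma (k - μ + 1)) *
        ((z - 1) / 2) ^ k

/-- The function `U_n^μ(z)`, defined by
`∂P_n^μ(z)/∂μ = (1/2) P_n^μ(z) ln((z+1)/(z-1)) + U_n^μ(z)`. -/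
def legendreU (n : ℕ) (μ z : ℂ) : ℂ :=
  deriv (fun w : ℂ => assocLegendreP n w z) μ
    - 1 / 2 * assocLegendreP n μ z * Complex.log ((z + 1) / (z - 1))

/-- The expansion of `U_n^μ(z)` in the functions `P_k^μ(z)`, `0 ≤ k ≤ n`. -/
def legendreUExpansion (n : ℕ) (μ z : ℂ) : ℂ :=
  Complex.digamma (n - μ + 1) * assocLegendreP n μ z +
    ∑ k ∈ Finset.range n,
      (-1 : ℂ) ^ (k + n) * ((2 * k + 1) / (((n : ℂ) - k) * (k + n + 1))) *
        (1 - (-1 : ℂ) ^ (k + n) *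
          ((Complex.Gamma (n + μ + 1) * Complex.Gamma (k - μ + 1)) /
            (Complex.Gamma (n - μ + 1) * Complex.Gamma (k + μ + 1)))) *
        assocLegendreP k μ z

/-- The expansion of `U_n^μ(z)` in the functions `P_k^μ(z)` and `P_k^{-μ}(-z)`. -/
def legendreUExpansion' (n : ℕ) (μ z : ℂ) : ℂ :=
  Complex.digamma (n - μ + 1) * assocLegendreP n μ z +
    ∑ k ∈ Finset.range n,
      (-1 : ℂ) ^ (k + n) * ((2 * k + 1) / (((n : ℂ) - k) * (k + n + 1))) *
        (assocLegendreP k μ z - (-1 : ℂ) ^ n *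
          (Complex.Gamma (n + μ + 1) / Complex.Gamma (n - μ + 1)) *
            assocLegendreP k (-μ) (-z))

/-- The associated Legendre differential operator of degree `n` and order `μ`,
`d/dz (1 - z²) d/dz + n(n+1) - μ²/(1 - z²)`. -/
def legendreOp (n : ℕ) (μ : ℂ) (f : ℂ → ℂ) (z : ℂ) : ℂ :=
  deriv (fun w : ℂ => (1 - w ^ 2) * deriv f w) z
    + (n * (n + 1)) * f z - μ ^ 2 / (1 - z ^ 2) * f z

end

/-! With `x = (z-1)/2`, `P_n^μ` is the prefactor times a polynomial `p_n` in `x`, and the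
logarithmic term is exactly the `μ`-derivative of the prefactor, so `U_n^μ` is the prefactor times
`∂p_n/∂μ`. Conjugating the Legendre operator by the prefactor gives, up to sign, an operator `L_n`
on polynomials with `L_n p_n = 0`; its `μ`-dependence is the term `-μ d/dx`, hence `L_n (∂p_n/∂μ) =
p_n'`. For noninteger `μ`, `p_n'` expands in the `p_k` with `k < n` (`derivative_legendrePoly`).
Each `p_k` is an eigenvector of `L_n`, so dividing by eigenvalues yields a particular solution; the
digamma multiple of `p_n` corrects the top coefficient, and `eq_zero_of_legendrePolyOp_eq_zero`
gives equality. The second expansion follows by the reflection `legendrePoly_neg_comp`. Integer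
orders are reached by continuity in `μ`. -/

noncomputable section

/-! ### Coefficient identities and the reciprocal Gamma function. -/

/-- The coefficient `(n+k)! / (k! (n-k)!)`, which is `0` for `k > n`. -/
def legendreCoeff (n k : ℕ) : ℂ :=
  if k ≤ n then ((k + n).factorial : ℂ) / ((k.factorial : ℂ) * ((n - k).factorial : ℂ)) else 0

lemma legendreCoeff_of_lt {n k : ℕ} (h : n < k) : legendreCoeff n k = 0 := by
  simp [legendreCoeff, h]

lemma legendreCoeff_self_ne_zero (n : ℕ) : legendreCoeff n n ≠ 0 := by
  simp [legendreCoeff, Nat.factorial_ne_zero]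

lemma succ_mul_legendreCoeff_succ (n j : ℕ) :
    ((j : ℂ) + 1) * legendreCoeff n (j + 1) = (n - j) * (n + j + 1) * legendreCoeff n j := by
  rcases lt_trichotomy j n with h | rfl | h
  · obtain ⟨d, rfl⟩ : ∃ d, n = j + (d + 1) := ⟨n - j - 1, by omega⟩
    have h1 : (j.factorial : ℂ) ≠ 0 := by exact_mod_cast j.factorial_ne_zero
    have h2 : (d.factorial : ℂ) ≠ 0 := by exact_mod_cast d.factorial_ne_zero
    have h3 : (j : ℂ) + 1 ≠ 0 := by exact_mod_cast j.succ_ne_zero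
    have h4 : (d : ℂ) + 1 ≠ 0 := by exact_mod_cast d.succ_ne_zero
    have e1 : j + (d + 1) - (j + 1) = d := by omega
    have e2 : j + (d + 1) - j = d + 1 := by omega
    have e3 : j + 1 + (j + (d + 1)) = (j + (j + (d + 1))) + 1 := by omega
    rw [legendreCoeff, legendreCoeff, if_pos (by omega), if_pos (by omega), e1, e2, e3]
    simp only [Nat.factorial_succ (j + (j + (d + 1))), Nat.factorial_succ j, Nat.factorial_succ d]
    push_cast
    field_simp
    ring
  · simp [legendreCoeff_of_lt]
  · simp [legendreCoeff_of_lt h, legendreCoeff_of_lt (show n < j + 1 by omega)]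

lemma legendreCoeff_succ_left (n j : ℕ) :
    ((n : ℂ) + 1 - j) * legendreCoeff (n + 1) j = (n + 1 + j) * legendreCoeff n j := by
  rcases lt_trichotomy j (n + 1) with h | rfl | h
  · obtain ⟨d, rfl⟩ : ∃ d, n = j + d := ⟨n - j, by omega⟩
    have h1 : (j.factorial : ℂ) ≠ 0 := by exact_mod_cast j.factorial_ne_zero
    have h2 : (d.factorial : ℂ) ≠ 0 := by exact_mod_cast d.factorial_ne_zero
    have h4 : (d : ℂ) + 1 ≠ 0 := by exact_mod_cast d.succ_ne_zero
    have e1 : j + d - j = d := by omega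
    have e2 : j + d + 1 - j = d + 1 := by omega
    have e3 : j + (j + d + 1) = (j + (j + d)) + 1 := by omega
    rw [legendreCoeff, legendreCoeff, if_pos (by omega), if_pos (by omega), e1, e2, e3]
    simp only [Nat.factorial_succ (j + (j + d)), Nat.factorial_succ d]
    push_cast
    field_simp
    ring
  · simp [legendreCoeff_of_lt]
  · simp [legendreCoeff_of_lt h, legendreCoeff_of_lt (show n < j by omega)]

/-- Telescopes by `legendreCoeff_succ_left`, since `(2n+1) - (n-j) = n+1+j`. -/
lemma sum_alternating_legendreCoeff (n j : ℕ) :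
    ∑ k ∈ Finset.range n, (-1 : ℂ) ^ k * (2 * k + 1) * legendreCoeff k j =
      -(-1) ^ n * ((n - j) * legendreCoeff n j) := by
  induction n with
  | zero =>
    rcases Nat.eq_zero_or_pos j with rfl | h
    · simp
    · simp [legendreCoeff_of_lt h]
  | succ n ih =>
    rw [Finset.sum_range_succ, ih]
    push_cast
    rw [legendreCoeff_succ_left]
    ring

/-- The entire function `1 / Γ`. -/
def rGamma (s : ℂ) : ℂ := (Complex.Gamma s)⁻¹

lemma differentiable_rGamma : Differentiable ℂ rGamma := Complex.differentiable_one_div_Gamma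

lemma rGamma_eq_self_mul (s : ℂ) : rGamma s = s * rGamma (s + 1) :=
  Complex.one_div_Gamma_eq_self_mul_one_div_Gamma_add_one s

/-- The extra term from the product rule becomes the inhomogeneity in
`legendrePolyOp_legendrePolyDeriv`. -/
lemma deriv_rGamma_eq (s : ℂ) :
    deriv rGamma s = rGamma (s + 1) + s * deriv rGamma (s + 1) := by
  have h : HasDerivAt rGamma (1 * rGamma (s + 1) + s * deriv rGamma (s + 1)) s := by
    have h1 : HasDerivAt (fun w : ℂ => rGamma (w + 1)) (deriv rGamma (s + 1)) s :=
      (differentiable_rGamma (s + 1)).hasDerivAt.comp_add_const s 1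
    exact ((hasDerivAt_id s).mul h1).congr_of_eventuallyEq
      (Filter.Eventually.of_forall fun w => rGamma_eq_self_mul w)
  rw [h.deriv, one_mul]

lemma deriv_rGamma_of_ne {s : ℂ} (h : ∀ m : ℕ, s ≠ -m) :
    deriv rGamma s = -(Complex.digamma s * rGamma s) := by
  have h1 : HasDerivAt rGamma _ s :=
    (Complex.differentiableAt_Gamma s h).hasDerivAt.inv (Complex.Gamma_ne_zero h)
  have h2 := Complex.Gamma_ne_zero h
  rw [h1.deriv, Complex.digamma, logDeriv_apply, rGamma]
  field_simp

/-- Also telescoping; this sum handles the Gamma-ratio half of the bracket in the first expansion,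
the alternating sum the other half. -/
lemma sum_gammaRatio_legendreCoeff {μ : ℂ} (hμ : ∀ m : ℕ, μ ≠ m) (hμ' : ∀ m : ℕ, μ ≠ -m)
    (n j : ℕ) :
    ∑ k ∈ Finset.range n, (2 * k + 1) * (Complex.Gamma (k - μ + 1) / Complex.Gamma (k + μ + 1)) *
        legendreCoeff k j * (j - μ + 1) =
      (n - j) * legendreCoeff n j * (n + μ) *
        (Complex.Gamma (n - μ + 1) / Complex.Gamma (n + μ + 1)) := by
  induction n with
  | zero =>
    rcases Nat.eq_zero_or_pos j with rfl | h
    · simp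
    · simp [legendreCoeff_of_lt h]
  | succ n ih =>
    have h1 : (n : ℂ) - μ + 1 ≠ 0 := fun h => hμ (n + 1) (by push_cast; linear_combination -h)
    have h2 : (n : ℂ) + μ + 1 ≠ 0 := fun h => hμ' (n + 1) (by push_cast; linear_combination h)
    have h3 : Complex.Gamma (n + μ + 1) ≠ 0 := Complex.Gamma_ne_zero fun m h =>
      hμ' (n + m + 1) (by push_cast; linear_combination h)
    have e1 : ((n + 1 : ℕ) : ℂ) - μ + 1 = (n - μ + 1) + 1 := by push_cast; ring
    have e2 : ((n + 1 : ℕ) : ℂ) + μ + 1 = (n + μ + 1) + 1 := by push_cast; ring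
    rw [Finset.sum_range_succ, ih, e1, e2, Complex.Gamma_add_one _ h1, Complex.Gamma_add_one _ h2]
    have := legendreCoeff_succ_left n j
    push_cast
    rw [this]
    field_simp
    ring

/-! ### The polynomial part and the conjugated operator. -/

open Polynomial

/-- The polynomial in `x = (z-1)/2` with `P_n^μ(z) = ((z+1)/(z-1))^(μ/2) · legendrePoly n μ x`. -/
def legendrePoly (n : ℕ) (μ : ℂ) : ℂ[X] :=
  ∑ k ∈ Finset.range (n + 1), monomial k (legendreCoeff n k * rGamma (k - μ + 1))

/-- The derivative of `legendrePoly n μ` with respect to `μ`. -/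
def legendrePolyDeriv (n : ℕ) (μ : ℂ) : ℂ[X] :=
  ∑ k ∈ Finset.range (n + 1), monomial k (-(legendreCoeff n k * deriv rGamma (k - μ + 1)))

lemma coeff_legendrePoly (n : ℕ) (μ : ℂ) (j : ℕ) :
    (legendrePoly n μ).coeff j = legendreCoeff n j * rGamma (j - μ + 1) := by
  simp only [legendrePoly, finsetSum_coeff, coeff_monomial, Finset.sum_ite_eq', Finset.mem_range]
  split_ifs with h
  · rfl
  · rw [legendreCoeff_of_lt (by omega), zero_mul]

lemma coeff_legendrePolyDeriv (n : ℕ) (μ : ℂ) (j : ℕ) :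
    (legendrePolyDeriv n μ).coeff j = -(legendreCoeff n j * deriv rGamma (j - μ + 1)) := by
  simp only [legendrePolyDeriv, finsetSum_coeff, coeff_monomial, Finset.sum_ite_eq',
    Finset.mem_range]
  split_ifs with h
  · rfl
  · rw [legendreCoeff_of_lt (by omega), zero_mul, neg_zero]

/-- The operator on polynomials conjugate to (minus) the associated Legendre operator. -/
def legendrePolyOp (n : ℕ) (μ : ℂ) : ℂ[X] →ₗ[ℂ] ℂ[X] :=
  LinearMap.mulLeft ℂ (X * (X + 1)) ∘ₗ derivative ∘ₗ derivative +
    LinearMap.mulLeft ℂ (2 * X + C (1 - μ)) ∘ₗ derivative -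
    ((n : ℂ) * (n + 1)) • LinearMap.id

lemma legendrePolyOp_apply (n : ℕ) (μ : ℂ) (p : ℂ[X]) :
    legendrePolyOp n μ p = X * (X + 1) * derivative (derivative p) +
      (2 * X + C (1 - μ)) * derivative p - C ((n : ℂ) * (n + 1)) * p := by
  simp [legendrePolyOp, smul_eq_C_mul, mul_assoc]

/-- The operator is bidiagonal on monomials, so its equations become two-term recursions. -/
lemma coeff_legendrePolyOp (n : ℕ) (μ : ℂ) (p : ℂ[X]) (j : ℕ) :
    (legendrePolyOp n μ p).coeff j =
      -((n - j) * (n + j + 1)) * p.coeff j + (j + 1) * (j - μ + 1) * p.coeff (j + 1) := by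
  have e : legendrePolyOp n μ p = X * (X * derivative (derivative p)) +
      X * derivative (derivative p) + C 2 * (X * derivative p) + C (1 - μ) * derivative p -
      C ((n : ℂ) * (n + 1)) * p := by
    rw [legendrePolyOp_apply, show (2 : ℂ[X]) = C 2 from rfl]; ring
  rw [e]
  simp only [coeff_add, coeff_sub, coeff_C_mul]
  rcases j with _ | _ | j
  · simp [coeff_derivative]; ring
  · simp [coeff_derivative, coeff_X_mul]; ring
  · simp [coeff_derivative, coeff_X_mul]; ring

lemma legendrePolyOp_legendrePoly (n : ℕ) (μ : ℂ) :
    legendrePolyOp n μ (legendrePoly n μ) = 0 := by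
  ext j
  rw [coeff_legendrePolyOp, coeff_legendrePoly, coeff_legendrePoly, rGamma_eq_self_mul (j - μ + 1),
    coeff_zero]
  have h := succ_mul_legendreCoeff_succ n j
  have e : ((j + 1 : ℕ) : ℂ) - μ + 1 = j - μ + 1 + 1 := by push_cast; ring
  rw [e]
  linear_combination (j - μ + 1) * rGamma (j - μ + 1 + 1) * h

lemma legendrePolyOp_legendrePolyDeriv (n : ℕ) (μ : ℂ) :
    legendrePolyOp n μ (legendrePolyDeriv n μ) = derivative (legendrePoly n μ) := by
  ext j
  rw [coeff_legendrePolyOp, coeff_legendrePolyDeriv, coeff_legendrePolyDeriv, coeff_derivative,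
    coeff_legendrePoly, deriv_rGamma_eq (j - μ + 1)]
  have h := succ_mul_legendreCoeff_succ n j
  have e : ((j + 1 : ℕ) : ℂ) - μ + 1 = j - μ + 1 + 1 := by push_cast; ring
  rw [e]
  linear_combination (-(j - μ + 1) * deriv rGamma (j - μ + 1 + 1) - rGamma (j - μ + 1 + 1)) * h

/-- Operators of degrees `n` and `k` differ only by the scalar `n(n+1) - k(k+1)`. -/
lemma legendrePolyOp_legendrePoly_of_degree (n k : ℕ) (μ : ℂ) :
    legendrePolyOp n μ (legendrePoly k μ) = -(((n : ℂ) - k) * (k + n + 1)) • legendrePoly k μ := by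
  have h := legendrePolyOp_legendrePoly k μ
  rw [legendrePolyOp_apply] at h ⊢
  rw [smul_eq_C_mul]
  have e : C (-(((n : ℂ) - k) * (k + n + 1))) = C ((k : ℂ) * (k + 1)) - C ((n : ℂ) * (n + 1)) := by
    rw [← C_sub]; congr 1; ring
  rw [e]
  linear_combination h

/-- A polynomial solution of degree at most `n` is determined by its coefficient of degree `n`. -/
lemma eq_zero_of_legendrePolyOp_eq_zero {n : ℕ} {μ : ℂ} {p : ℂ[X]}
    (h : legendrePolyOp n μ p = 0) (hp : ∀ j, n ≤ j → p.coeff j = 0) : p = 0 := by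
  -- Descending induction on `j`: below `n` the diagonal entry `-(n-j)(n+j+1)` is nonzero, so each
  -- coefficient is forced by the next one.
  have key : ∀ d j, n ≤ j + d → p.coeff j = 0 := by
    intro d
    induction d with
    | zero => exact hp
    | succ d ih =>
      intro j hj
      rcases Nat.lt_or_ge j n with hjn | hjn
      · have h1 := coeff_legendrePolyOp n μ p j
        rw [h, ih (j + 1) (by omega), coeff_zero, mul_zero, add_zero] at h1
        have h2 : (n : ℂ) - j ≠ 0 := sub_ne_zero.2 (by exact_mod_cast hjn.ne')
        have h3 : (n : ℂ) + j + 1 ≠ 0 := by exact_mod_cast (n + j).succ_ne_zero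
        have h4 : -(((n : ℂ) - j) * (n + j + 1)) ≠ 0 := neg_ne_zero.2 (mul_ne_zero h2 h3)
        exact (mul_eq_zero.1 h1.symm).resolve_left h4
      · exact hp j hjn
  ext j
  rw [key n j (by omega), coeff_zero]

/-- Coefficientwise, the two telescoped sums contribute the factors `j-μ+1` and `n+μ`, which add up
to the `n+j+1` of `succ_mul_legendreCoeff_succ`. -/
lemma derivative_legendrePoly {μ : ℂ} (hμ : ∀ m : ℕ, μ ≠ m) (hμ' : ∀ m : ℕ, μ ≠ -m) (n : ℕ) :
    derivative (legendrePoly n μ) = -∑ k ∈ Finset.range n,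
      ((-1 : ℂ) ^ (k + n) * (2 * k + 1) * (1 - (-1 : ℂ) ^ (k + n) *
          ((Complex.Gamma (n + μ + 1) * Complex.Gamma (k - μ + 1)) /
            (Complex.Gamma (n - μ + 1) * Complex.Gamma (k + μ + 1))))) • legendrePoly k μ := by
  ext j
  simp only [coeff_derivative, coeff_neg, finsetSum_coeff, coeff_smul, coeff_legendrePoly,
    smul_eq_mul]
  have hj : (j : ℂ) - μ + 1 ≠ 0 := fun h => hμ (j + 1) (by push_cast; linear_combination -h)
  have g1 : Complex.Gamma (n + μ + 1) ≠ 0 := Complex.Gamma_ne_zero fun m h =>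
    hμ' (n + m + 1) (by push_cast; linear_combination h)
  have g2 : Complex.Gamma (n - μ + 1) ≠ 0 := Complex.Gamma_ne_zero fun m h =>
    hμ (n + m + 1) (by push_cast; linear_combination -h)
  have hA := sum_alternating_legendreCoeff n j
  have hB := sum_gammaRatio_legendreCoeff hμ hμ' n j
  have hs : ((-1 : ℂ) ^ n) * (-1) ^ n = 1 := by rw [← mul_pow]; simp
  set r := Complex.Gamma (n + μ + 1) / Complex.Gamma (n - μ + 1) with hr
  have e : ((j + 1 : ℕ) : ℂ) - μ + 1 = j - μ + 1 + 1 := by push_cast; ring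
  have hsum : ∑ k ∈ Finset.range n, ((-1 : ℂ) ^ (k + n) * (2 * k + 1) * (1 - (-1 : ℂ) ^ (k + n) *
          ((Complex.Gamma (n + μ + 1) * Complex.Gamma (k - μ + 1)) /
            (Complex.Gamma (n - μ + 1) * Complex.Gamma (k + μ + 1))))) *
            (legendreCoeff k j * rGamma (j - μ + 1)) =
      rGamma (j - μ + 1 + 1) * (
        (-1 : ℂ) ^ n * (j - μ + 1) *
          ∑ k ∈ Finset.range n, (-1 : ℂ) ^ k * (2 * k + 1) * legendreCoeff k j
        - r * ∑ k ∈ Finset.range n, (2 * k + 1) *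
          (Complex.Gamma (k - μ + 1) / Complex.Gamma (k + μ + 1)) *
          legendreCoeff k j * (j - μ + 1)) := by
    rw [Finset.mul_sum, Finset.mul_sum, ← Finset.sum_sub_distrib, Finset.mul_sum]
    refine Finset.sum_congr rfl fun k _ => ?_
    have hs' : ((-1 : ℂ) ^ (k + n)) * (-1) ^ (k + n) = 1 := by rw [← mul_pow]; simp
    rw [rGamma_eq_self_mul (j - μ + 1), mul_div_mul_comm, ← hr]
    linear_combination (-(2 * k + 1) * r * (Complex.Gamma (k - μ + 1) / Complex.Gamma (k + μ + 1)) *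
      (legendreCoeff k j * ((j - μ + 1) * rGamma (j - μ + 1 + 1)))) * hs' +
      (2 * k + 1) * (legendreCoeff k j * ((j - μ + 1) * rGamma (j - μ + 1 + 1))) *
        pow_add (-1 : ℂ) k n
  have hr' : r * (Complex.Gamma (n - μ + 1) / Complex.Gamma (n + μ + 1)) = 1 := by
    rw [hr]; field_simp
  rw [hsum, hA, hB, e]
  have h := succ_mul_legendreCoeff_succ n j
  linear_combination rGamma (j - μ + 1 + 1) * h -
    rGamma (j - μ + 1 + 1) * (j - μ + 1) * ((n - j) * legendreCoeff n j) * hs -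
    rGamma (j - μ + 1 + 1) * (n - j) * legendreCoeff n j * (n + μ) * hr'

lemma legendrePolyDeriv_eq {μ : ℂ} (hμ : ∀ m : ℕ, μ ≠ m) (hμ' : ∀ m : ℕ, μ ≠ -m) (n : ℕ) :
    legendrePolyDeriv n μ = Complex.digamma (n - μ + 1) • legendrePoly n μ +
      ∑ k ∈ Finset.range n, ((-1 : ℂ) ^ (k + n) * ((2 * k + 1) / (((n : ℂ) - k) * (k + n + 1))) *
        (1 - (-1 : ℂ) ^ (k + n) *
          ((Complex.Gamma (n + μ + 1) * Complex.Gamma (k - μ + 1)) /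
            (Complex.Gamma (n - μ + 1) * Complex.Gamma (k + μ + 1))))) • legendrePoly k μ := by
  rw [← sub_eq_zero]
  apply eq_zero_of_legendrePolyOp_eq_zero (n := n) (μ := μ)
  · rw [map_sub, map_add, map_smul, legendrePolyOp_legendrePoly, smul_zero, zero_add, map_sum,
      legendrePolyOp_legendrePolyDeriv, derivative_legendrePoly hμ hμ', sub_eq_zero,
      ← Finset.sum_neg_distrib]
    refine Finset.sum_congr rfl fun k hk => ?_
    rw [map_smul, legendrePolyOp_legendrePoly_of_degree, smul_smul, ← neg_smul]
    congr 1
    have h2 : (n : ℂ) - k ≠ 0 := sub_ne_zero.2 (by exact_mod_cast (Finset.mem_range.1 hk).ne')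
    have h3 : (k : ℂ) + n + 1 ≠ 0 := by exact_mod_cast (k + n).succ_ne_zero
    have h4 : (2 * (k : ℂ) + 1) / (((n : ℂ) - k) * (k + n + 1)) * (((n : ℂ) - k) * (k + n + 1)) =
      2 * k + 1 := by field_simp
    linear_combination ((-1 : ℂ) ^ (k + n) * (1 - (-1 : ℂ) ^ (k + n) *
      ((Complex.Gamma (n + μ + 1) * Complex.Gamma (k - μ + 1)) /
        (Complex.Gamma (n - μ + 1) * Complex.Gamma (k + μ + 1))))) * h4
  · intro j hj
    have hz : ∑ k ∈ Finset.range n, (((-1 : ℂ) ^ (k + n) *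
        ((2 * k + 1) / (((n : ℂ) - k) * (k + n + 1))) *
        (1 - (-1 : ℂ) ^ (k + n) *
          ((Complex.Gamma (n + μ + 1) * Complex.Gamma (k - μ + 1)) /
            (Complex.Gamma (n - μ + 1) * Complex.Gamma (k + μ + 1))))) •
              legendrePoly k μ).coeff j = 0 := by
      refine Finset.sum_eq_zero fun k hk => ?_
      rw [coeff_smul, coeff_legendrePoly,
        legendreCoeff_of_lt ((Finset.mem_range.1 hk).trans_le hj), zero_mul, smul_zero]
    rw [coeff_sub, coeff_add, finsetSum_coeff, hz, coeff_smul, coeff_legendrePoly,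
      coeff_legendrePolyDeriv]
    -- Only degree `n` needs an argument: there the logarithmic derivative of `1/Γ` produces the
    -- digamma factor.
    rcases hj.eq_or_lt with rfl | hj
    · rw [deriv_rGamma_of_ne fun m h => hμ (n + m + 1) (by push_cast; linear_combination -h),
        smul_eq_mul]
      ring
    · simp [legendreCoeff_of_lt hj]

/-- The substitution `x ↦ -1-x`, which is `z ↦ -z`, turns the operator of order `-μ` into that of
order `μ`. Both sides are thus solutions of degree at most `k`, and the scalar matches their top
coefficients. -/
lemma legendrePoly_neg_comp {μ : ℂ} (hμ : ∀ m : ℕ, μ ≠ m) (hμ' : ∀ m : ℕ, μ ≠ -m) (k : ℕ) :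
    (legendrePoly k (-μ)).comp (-1 - X) =
      ((-1 : ℂ) ^ k * (Complex.Gamma (k - μ + 1) / Complex.Gamma (k + μ + 1))) •
        legendrePoly k μ := by
  have g1 : Complex.Gamma (k + μ + 1) ≠ 0 := Complex.Gamma_ne_zero fun m h =>
    hμ' (k + m + 1) (by push_cast; linear_combination h)
  have g2 : Complex.Gamma (k - μ + 1) ≠ 0 := Complex.Gamma_ne_zero fun m h =>
    hμ (k + m + 1) (by push_cast; linear_combination -h)
  have hq : (-1 - X : ℂ[X]) = C (-1) * X + C (-1) := by simp; ring
  have hqd : (-1 - X : ℂ[X]).natDegree = 1 := by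
    rw [hq]; exact natDegree_linear (by simp)
  have hql : (-1 - X : ℂ[X]).leadingCoeff = -1 := by
    rw [hq]; exact leadingCoeff_linear (by simp)
  have hd : (legendrePoly k (-μ)).natDegree = k := by
    refine natDegree_eq_of_le_of_coeff_ne_zero ?_ ?_
    · exact natDegree_le_iff_coeff_eq_zero.2 fun j hj => by
        rw [coeff_legendrePoly, legendreCoeff_of_lt hj, zero_mul]
    · rw [coeff_legendrePoly, sub_neg_eq_add]
      exact mul_ne_zero (legendreCoeff_self_ne_zero k) (inv_ne_zero g1)
  have hcd : ((legendrePoly k (-μ)).comp (-1 - X)).natDegree = k := by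
    rw [natDegree_comp, hd, hqd, mul_one]
  rw [← sub_eq_zero]
  apply eq_zero_of_legendrePolyOp_eq_zero (n := k) (μ := μ)
  · rw [map_sub, map_smul, legendrePolyOp_legendrePoly, smul_zero, sub_zero]
    have h := congrArg (fun p : ℂ[X] => p.comp (-1 - X)) (legendrePolyOp_legendrePoly k (-μ))
    simp only [legendrePolyOp_apply, sub_comp, add_comp, mul_comp, X_comp, one_comp, C_comp,
      zero_comp, ofNat_comp] at h
    rw [legendrePolyOp_apply]
    simp only [derivative_comp, derivative_mul, derivative_sub, derivative_neg, derivative_one,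
      derivative_X, derivative_zero]
    simp only [map_sub, map_neg, map_one, Nat.cast_ofNat] at h ⊢
    linear_combination h
  · intro j hj
    rcases hj.eq_or_lt with rfl | hj
    · have h1 : ((legendrePoly k (-μ)).comp (-1 - X)).coeff k =
          (legendrePoly k (-μ)).coeff k * (-1) ^ k := by
        have := coeff_comp_degree_mul_degree (p := legendrePoly k (-μ)) (q := -1 - X)
          (by rw [hqd]; exact one_ne_zero)
        rwa [hqd, hql, leadingCoeff, hd, mul_one] at this
      rw [coeff_sub, h1, coeff_smul, coeff_legendrePoly, coeff_legendrePoly, sub_neg_eq_add,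
        smul_eq_mul, rGamma, rGamma]
      field_simp
      ring
    · rw [coeff_sub, coeff_eq_zero_of_natDegree_lt (by rw [hcd]; exact hj), coeff_smul,
        coeff_legendrePoly, legendreCoeff_of_lt hj, zero_mul, smul_zero, sub_zero]

/-! ### The cut plane, the prefactor and the return to functions of `z`. -/

lemma isOpen_cutPlane : IsOpen cutPlane :=
  ((isCompact_Icc.image Complex.continuous_ofReal).isClosed).isOpen_compl

lemma sub_one_ne_zero_of_mem_cutPlane {z : ℂ} (hz : z ∈ cutPlane) : z - 1 ≠ 0 := fun h =>
  hz ⟨1, by norm_num, by rw [sub_eq_zero.1 h]; simp⟩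

lemma add_one_ne_zero_of_mem_cutPlane {z : ℂ} (hz : z ∈ cutPlane) : z + 1 ≠ 0 := fun h =>
  hz ⟨-1, by norm_num, by rw [eq_neg_of_add_eq_zero_left h]; simp⟩

lemma div_mem_slitPlane_of_mem_cutPlane {z : ℂ} (hz : z ∈ cutPlane) :
    (z + 1) / (z - 1) ∈ Complex.slitPlane := by
  have h1 := sub_one_ne_zero_of_mem_cutPlane hz
  by_contra h
  rw [Complex.mem_slitPlane_iff_not_le_zero, not_not] at h
  obtain ⟨t, ht, htz⟩ : ∃ t : ℝ, t ≤ 0 ∧ (z + 1) / (z - 1) = t := by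
    rw [Complex.le_def] at h
    exact ⟨((z + 1) / (z - 1)).re, by simpa using h.1,
      Complex.ext (by simp) (by simpa using h.2)⟩
  have ht1 : t - 1 < 0 := by linarith
  have ht2 : ((t : ℂ) - 1) ≠ 0 := by exact_mod_cast ht1.ne
  rw [div_eq_iff h1] at htz
  -- The Möbius map `z ↦ (z+1)/(z-1)` is an involution, so this real point of `[-1, 1]` is `z`
  -- itself.
  refine hz ⟨(t + 1) / (t - 1), ⟨?_, ?_⟩, ?_⟩
  · rw [le_div_iff_of_neg ht1]; linarith
  · rw [div_le_iff_of_neg ht1]; linarith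
  · push_cast
    rw [div_eq_iff ht2]
    linear_combination htz

lemma neg_mem_cutPlane {z : ℂ} (hz : z ∈ cutPlane) : -z ∈ cutPlane := by
  rintro ⟨t, ⟨h1, h2⟩, ht⟩
  exact hz ⟨-t, ⟨by linarith, by linarith⟩, by simp [ht]⟩

lemma one_sub_sq_ne_zero_of_mem_cutPlane {z : ℂ} (hz : z ∈ cutPlane) : 1 - z ^ 2 ≠ 0 := by
  rw [show 1 - z ^ 2 = -((z - 1) * (z + 1)) by ring]
  exact neg_ne_zero.2 (mul_ne_zero (sub_one_ne_zero_of_mem_cutPlane hz)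
    (add_one_ne_zero_of_mem_cutPlane hz))

/-- The factor `((z+1)/(z-1))^(μ/2)`. -/
def legendrePrefactor (μ z : ℂ) : ℂ := ((z + 1) / (z - 1)) ^ (μ / 2)

lemma assocLegendreP_eq (n : ℕ) (μ z : ℂ) :
    assocLegendreP n μ z = legendrePrefactor μ z * (legendrePoly n μ).eval ((z - 1) / 2) := by
  rw [assocLegendreP, legendrePrefactor, legendrePoly, eval_finsetSum]
  congr 1
  refine Finset.sum_congr rfl fun k hk => ?_
  rw [eval_monomial, legendreCoeff, if_pos (Nat.lt_succ_iff.1 (Finset.mem_range.1 hk)), rGamma]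
  simp only [div_eq_mul_inv, mul_inv]
  ring

lemma hasDerivAt_eval_legendrePoly (n : ℕ) (μ x : ℂ) :
    HasDerivAt (fun w : ℂ => (legendrePoly n w).eval x) ((legendrePolyDeriv n μ).eval x) μ := by
  simp only [legendrePoly, legendrePolyDeriv, eval_finsetSum, eval_monomial]
  refine HasDerivAt.fun_sum fun k _ => ?_
  have h1 : HasDerivAt (fun w : ℂ => (k : ℂ) - w + 1) (-1) μ :=
    ((hasDerivAt_id μ).const_sub (k : ℂ)).add_const 1
  have h2 := ((differentiable_rGamma (k - μ + 1)).hasDerivAt.comp μ h1).const_mul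
    (legendreCoeff n k)
  exact (h2.mul_const (x ^ k)).congr_deriv (by ring)

lemma hasDerivAt_assocLegendreP_order (n : ℕ) (μ : ℂ) {z : ℂ} (hz : z ∈ cutPlane) :
    HasDerivAt (fun w : ℂ => assocLegendreP n w z)
      (1 / 2 * assocLegendreP n μ z * Complex.log ((z + 1) / (z - 1)) +
        legendrePrefactor μ z * (legendrePolyDeriv n μ).eval ((z - 1) / 2)) μ := by
  have h0 : (z + 1) / (z - 1) ≠ 0 :=
    div_ne_zero (add_one_ne_zero_of_mem_cutPlane hz) (sub_one_ne_zero_of_mem_cutPlane hz)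
  have h1 : HasDerivAt (fun w : ℂ => legendrePrefactor w z)
      (legendrePrefactor μ z * Complex.log ((z + 1) / (z - 1)) * (1 / 2)) μ :=
    ((hasDerivAt_id μ).div_const 2).const_cpow (Or.inl h0)
  simp only [assocLegendreP_eq]
  exact (h1.mul (hasDerivAt_eval_legendrePoly n μ ((z - 1) / 2))).congr_deriv (by ring)

lemma legendreU_eq (n : ℕ) (μ : ℂ) {z : ℂ} (hz : z ∈ cutPlane) :
    legendreU n μ z =
      legendrePrefactor μ z * (legendrePolyDeriv n μ).eval ((z - 1) / 2) := by
  rw [legendreU, (hasDerivAt_assocLegendreP_order n μ hz).deriv]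
  ring

lemma hasDerivAt_legendrePrefactor (μ : ℂ) {z : ℂ} (hz : z ∈ cutPlane) :
    HasDerivAt (legendrePrefactor μ) (legendrePrefactor μ z * (μ / (1 - z ^ 2))) z := by
  have h1 := sub_one_ne_zero_of_mem_cutPlane hz
  have h2 := add_one_ne_zero_of_mem_cutPlane hz
  have hd : HasDerivAt (fun w : ℂ => (w + 1) / (w - 1))
      ((1 * (z - 1) - (z + 1) * 1) / (z - 1) ^ 2) z :=
    ((hasDerivAt_id z).add_const 1).div ((hasDerivAt_id z).sub_const 1) h1
  have h3 := one_sub_sq_ne_zero_of_mem_cutPlane hz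
  refine (hd.cpow_const (c := μ / 2) (div_mem_slitPlane_of_mem_cutPlane hz)).congr_deriv ?_
  rw [Complex.cpow_sub _ _ (div_ne_zero h2 h1), Complex.cpow_one, legendrePrefactor]
  field_simp
  ring

lemma hasDerivAt_eval_half (p : ℂ[X]) (z : ℂ) :
    HasDerivAt (fun w : ℂ => p.eval ((w - 1) / 2)) ((derivative p).eval ((z - 1) / 2) / 2) z := by
  have h1 : HasDerivAt (fun w : ℂ => (w - 1) / 2) (1 / 2) z :=
    ((hasDerivAt_id z).sub_const 1).div_const 2
  refine ((p.hasDerivAt ((z - 1) / 2)).comp z h1).congr_deriv ?_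
  ring

lemma hasDerivAt_legendrePrefactor_mul_eval (μ : ℂ) (p : ℂ[X]) {z : ℂ} (hz : z ∈ cutPlane) :
    HasDerivAt (fun w : ℂ => legendrePrefactor μ w * p.eval ((w - 1) / 2))
      (legendrePrefactor μ z * (μ / (1 - z ^ 2)) * p.eval ((z - 1) / 2) +
        legendrePrefactor μ z * ((derivative p).eval ((z - 1) / 2) / 2)) z :=
  (hasDerivAt_legendrePrefactor μ hz).mul (hasDerivAt_eval_half p z)

lemma legendreOp_prefactor_mul_eval (n : ℕ) (μ : ℂ) (p : ℂ[X]) {f : ℂ → ℂ}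
    (hf : ∀ z ∈ cutPlane, f z = legendrePrefactor μ z * p.eval ((z - 1) / 2))
    {z : ℂ} (hz : z ∈ cutPlane) :
    legendreOp n μ f z =
      -(legendrePrefactor μ z * (legendrePolyOp n μ p).eval ((z - 1) / 2)) := by
  -- The factor `1 - w²` cancels the denominator of the prefactor's logarithmic derivative, leaving
  -- terms of the same shape to differentiate again.
  have hderiv : ∀ w ∈ cutPlane, (1 - w ^ 2) * deriv f w = legendrePrefactor μ w *
      (C μ * p).eval ((w - 1) / 2) + (1 - w ^ 2) *
        (legendrePrefactor μ w * ((C (1 / 2) * derivative p).eval ((w - 1) / 2))) := by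
    intro w hw
    have he : f =ᶠ[𝓝 w] fun w => legendrePrefactor μ w * p.eval ((w - 1) / 2) :=
      Filter.eventually_of_mem (isOpen_cutPlane.mem_nhds hw) hf
    rw [he.deriv_eq, (hasDerivAt_legendrePrefactor_mul_eval μ p hw).deriv]
    have h3 := one_sub_sq_ne_zero_of_mem_cutPlane hw
    simp only [eval_mul, eval_C]
    field_simp
  have he : (fun w => (1 - w ^ 2) * deriv f w) =ᶠ[𝓝 z] _ :=
    Filter.eventually_of_mem (isOpen_cutPlane.mem_nhds hz) hderiv
  have hsq : HasDerivAt (fun w : ℂ => 1 - w ^ 2) (-(2 * z)) z := by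
    simpa using (hasDerivAt_pow 2 z).const_sub 1
  have h3 := one_sub_sq_ne_zero_of_mem_cutPlane hz
  have hd := (hasDerivAt_legendrePrefactor_mul_eval μ (C μ * p) hz).fun_add
    (hsq.fun_mul (hasDerivAt_legendrePrefactor_mul_eval μ (C (1 / 2) * derivative p) hz))
  rw [legendreOp, he.deriv_eq, hd.deriv, hf z hz, legendrePolyOp_apply]
  simp only [derivative_C_mul, eval_mul, eval_add, eval_sub, eval_C, eval_X, eval_one, eval_ofNat]
  field_simp
  ring

lemma legendreU_eq_expansion {μ : ℂ} (hμ : ∀ m : ℕ, μ ≠ m) (hμ' : ∀ m : ℕ, μ ≠ -m) (n : ℕ)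
    {z : ℂ} (hz : z ∈ cutPlane) : legendreU n μ z = legendreUExpansion n μ z := by
  rw [legendreU_eq n μ hz, legendrePolyDeriv_eq hμ hμ', legendreUExpansion, eval_add, mul_add,
    eval_finsetSum, Finset.mul_sum]
  congr 1
  · rw [eval_smul, assocLegendreP_eq, smul_eq_mul]; ring
  · refine Finset.sum_congr rfl fun k _ => ?_
    rw [eval_smul, assocLegendreP_eq, smul_eq_mul]; ring

/-- Negating `z` inverts the quotient, and the principal power respects inversion off the negative
axis. -/
lemma legendrePrefactor_neg_neg (μ : ℂ) {z : ℂ} (hz : z ∈ cutPlane) :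
    legendrePrefactor (-μ) (-z) = legendrePrefactor μ z := by
  have e : (-z + 1) / (-z - 1) = ((z + 1) / (z - 1))⁻¹ := by
    rw [inv_div, ← neg_div_neg_eq]; congr 1 <;> ring
  rw [legendrePrefactor, legendrePrefactor, e, neg_div, Complex.cpow_neg, Complex.inv_cpow,
    inv_inv]
  exact Complex.slitPlane_arg_ne_pi (div_mem_slitPlane_of_mem_cutPlane hz)

lemma assocLegendreP_neg_neg {μ : ℂ} (hμ : ∀ m : ℕ, μ ≠ m) (hμ' : ∀ m : ℕ, μ ≠ -m) (k : ℕ)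
    {z : ℂ} (hz : z ∈ cutPlane) :
    assocLegendreP k (-μ) (-z) = (-1 : ℂ) ^ k *
      (Complex.Gamma (k - μ + 1) / Complex.Gamma (k + μ + 1)) * assocLegendreP k μ z := by
  have h := congrArg (eval ((z - 1) / 2)) (legendrePoly_neg_comp hμ hμ' k)
  rw [eval_comp, eval_smul, smul_eq_mul] at h
  have e : eval ((z - 1) / 2) (-1 - X) = (-z - 1) / 2 := by simp; ring
  rw [e] at h
  rw [assocLegendreP_eq, assocLegendreP_eq, legendrePrefactor_neg_neg μ hz, h]
  ring

lemma legendreU_eq_expansion' {μ : ℂ} (hμ : ∀ m : ℕ, μ ≠ m) (hμ' : ∀ m : ℕ, μ ≠ -m) (n : ℕ)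
    {z : ℂ} (hz : z ∈ cutPlane) : legendreU n μ z = legendreUExpansion' n μ z := by
  rw [legendreU_eq_expansion hμ hμ' n hz, legendreUExpansion, legendreUExpansion']
  congr 1
  refine Finset.sum_congr rfl fun k _ => ?_
  rw [assocLegendreP_neg_neg hμ hμ' k hz, mul_div_mul_comm, pow_add]
  ring

/-! ### Continuity in the order and passage to integer orders. -/

lemma eventually_ne_int (μ : ℂ) :
    ∀ᶠ w : ℂ in 𝓝[≠] μ, (∀ m : ℕ, w ≠ m) ∧ (∀ m : ℕ, w ≠ -m) := by
  have hc : IsClosed (((↑) : ℤ → ℂ) '' {m | (m : ℂ) ≠ μ}) :=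
    Complex.isClosedEmbedding_intCast.isClosedMap _ (isClosed_discrete _)
  have h : (((↑) : ℤ → ℂ) '' {m | (m : ℂ) ≠ μ})ᶜ ∈ 𝓝 μ :=
    hc.isOpen_compl.mem_nhds fun ⟨_, h1, h2⟩ => h1 h2
  filter_upwards [mem_nhdsWithin_of_mem_nhds h, self_mem_nhdsWithin] with w hw hwμ
  have hw' : ∀ m : ℤ, w ≠ m := fun m hm => hw ⟨m, fun h => hwμ (hm.trans h), hm.symm⟩
  exact ⟨fun m hm => hw' m (by simpa using hm), fun m hm => hw' (-m) (by simpa using hm)⟩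

lemma continuous_assocLegendreP_order (n : ℕ) {z : ℂ} (hz : z ∈ cutPlane) :
    Continuous fun w => assocLegendreP n w z :=
  continuous_iff_continuousAt.2 fun w => (hasDerivAt_assocLegendreP_order n w hz).continuousAt

lemma continuous_legendreU_order (n : ℕ) {z : ℂ} (hz : z ∈ cutPlane) :
    Continuous fun w => legendreU n w z := by
  have h0 : (z + 1) / (z - 1) ≠ 0 :=
    div_ne_zero (add_one_ne_zero_of_mem_cutPlane hz) (sub_one_ne_zero_of_mem_cutPlane hz)
  have hD : Differentiable ℂ (fun w => assocLegendreP n w z) := fun w =>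
    (hasDerivAt_assocLegendreP_order n w hz).differentiableAt
  have hd : Continuous (deriv fun w => assocLegendreP n w z) :=
    (hD.contDiff (n := 1)).continuous_deriv le_rfl
  exact hd.sub ((continuous_const.mul (continuous_assocLegendreP_order n hz)).mul continuous_const)

lemma tendsto_legendreUExpansion (n : ℕ) (μ : ℂ) {z : ℂ} (hz : z ∈ cutPlane) :
    Filter.Tendsto (fun w : ℂ => legendreUExpansion n w z) (𝓝[≠] μ) (𝓝 (legendreU n μ z)) :=
  (((continuous_legendreU_order n hz).tendsto μ).mono_left nhdsWithin_le_nhds).congr'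
    ((eventually_ne_int μ).mono fun _ hw => legendreU_eq_expansion hw.1 hw.2 n hz)

lemma tendsto_legendreUExpansion' (n : ℕ) (μ : ℂ) {z : ℂ} (hz : z ∈ cutPlane) :
    Filter.Tendsto (fun w : ℂ => legendreUExpansion' n w z) (𝓝[≠] μ) (𝓝 (legendreU n μ z)) :=
  (((continuous_legendreU_order n hz).tendsto μ).mono_left nhdsWithin_le_nhds).congr'
    ((eventually_ne_int μ).mono fun _ hw => legendreU_eq_expansion' hw.1 hw.2 n hz)

/-- Near `s`, digamma is `-(1/Γ)' Γ`, where `1/Γ` is entire and `Γ` is continuous at `s`. -/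
lemma continuousAt_digamma {s : ℂ} (h : ∀ m : ℕ, s ≠ -m) : ContinuousAt Complex.digamma s := by
  have hne : ∀ᶠ w in 𝓝 s, Complex.digamma w = -(deriv rGamma w * Complex.Gamma w) := by
    have h1 : ∀ᶠ w in 𝓝 s, Complex.Gamma w ≠ 0 :=
      (Complex.differentiableAt_Gamma s h).continuousAt.eventually_ne (Complex.Gamma_ne_zero h)
    filter_upwards [h1] with w hw
    have hw' : ∀ m : ℕ, w ≠ -m := fun m hm => hw (by rw [hm, Complex.Gamma_neg_nat_eq_zero])
    rw [deriv_rGamma_of_ne hw', rGamma]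
    field_simp
  have hd : Continuous (deriv rGamma) :=
    (differentiable_rGamma.contDiff (n := 1)).continuous_deriv le_rfl
  exact ((hd.continuousAt.mul (Complex.differentiableAt_Gamma s h).continuousAt).neg).congr
    (hne.mono fun _ hw => hw.symm)

lemma continuousAt_legendreUExpansion (n : ℕ) {μ : ℂ} (hμ : ∀ m : ℕ, 1 ≤ m → μ ≠ m)
    (hμ' : ∀ m : ℕ, n < m → μ ≠ -m) {z : ℂ} (hz : z ∈ cutPlane) :
    ContinuousAt (fun w : ℂ => legendreUExpansion n w z) μ := by
  have hP := fun k => (continuous_assocLegendreP_order k hz).continuousAt (x := μ)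
  have hsub : ∀ k : ℕ, ContinuousAt (fun w : ℂ => (k : ℂ) - w + 1) μ := fun k => by fun_prop
  have hadd : ∀ k : ℕ, ContinuousAt (fun w : ℂ => (k : ℂ) + w + 1) μ := fun k => by fun_prop
  have hneg : ∀ k m : ℕ, (k : ℂ) - μ + 1 ≠ -m := fun k m h =>
    hμ (k + m + 1) (by omega) (by push_cast; linear_combination -h)
  have hpos : ∀ m : ℕ, (n : ℂ) + μ + 1 ≠ -m := fun m h =>
    hμ' (n + m + 1) (by omega) (by push_cast; linear_combination h)
  have hψ : ContinuousAt (fun w : ℂ => Complex.digamma (n - w + 1)) μ :=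
    ContinuousAt.comp' (continuousAt_digamma (hneg n)) (hsub n)
  have hG1 : ContinuousAt (fun w : ℂ => Complex.Gamma (n + w + 1)) μ :=
    ContinuousAt.comp' (Complex.differentiableAt_Gamma _ hpos).continuousAt (hadd n)
  have hG2 : ∀ k : ℕ, ContinuousAt (fun w : ℂ => Complex.Gamma (k - w + 1)) μ := fun k =>
    ContinuousAt.comp' (Complex.differentiableAt_Gamma _ (hneg k)).continuousAt (hsub k)
  have hr1 : ContinuousAt (fun w : ℂ => rGamma (n - w + 1)) μ :=
    ContinuousAt.comp' (differentiable_rGamma _).continuousAt (hsub n)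
  have hr2 : ∀ k : ℕ, ContinuousAt (fun w : ℂ => rGamma (k + w + 1)) μ := fun k =>
    ContinuousAt.comp' (differentiable_rGamma _).continuousAt (hadd k)
  unfold legendreUExpansion
  -- Denominators become values of the entire `1/Γ`, so only numerator poles obstruct continuity.
  simp only [div_eq_mul_inv (Complex.Gamma _ * Complex.Gamma _), mul_inv (Complex.Gamma _)]
  refine (hψ.mul (hP n)).add (tendsto_finsetSum _ fun k _ => ?_)
  exact ((continuousAt_const.mul (continuousAt_const.sub (continuousAt_const.mul
    ((hG1.mul (hG2 k)).mul (hr1.mul (hr2 k)))))).mul (hP k))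

lemma continuousAt_legendreUExpansion' (n : ℕ) {μ : ℂ} (hμ : ∀ m : ℕ, n < m → μ ≠ m)
    (hμ' : ∀ m : ℕ, n < m → μ ≠ -m) {z : ℂ} (hz : z ∈ cutPlane) :
    ContinuousAt (fun w : ℂ => legendreUExpansion' n w z) μ := by
  have hP := fun k => (continuous_assocLegendreP_order k hz).continuousAt (x := μ)
  have hP' : ∀ k, ContinuousAt (fun w => assocLegendreP k (-w) (-z)) μ := fun k =>
    ((continuous_assocLegendreP_order k (neg_mem_cutPlane hz)).comp continuous_neg).continuousAt
  have hsub : ContinuousAt (fun w : ℂ => (n : ℂ) - w + 1) μ := by fun_prop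
  have hadd : ContinuousAt (fun w : ℂ => (n : ℂ) + w + 1) μ := by fun_prop
  have hneg : ∀ m : ℕ, (n : ℂ) - μ + 1 ≠ -m := fun m h =>
    hμ (n + m + 1) (by omega) (by push_cast; linear_combination -h)
  have hpos : ∀ m : ℕ, (n : ℂ) + μ + 1 ≠ -m := fun m h =>
    hμ' (n + m + 1) (by omega) (by push_cast; linear_combination h)
  have hψ : ContinuousAt (fun w : ℂ => Complex.digamma (n - w + 1)) μ :=
    ContinuousAt.comp' (continuousAt_digamma hneg) hsub
  have hG1 : ContinuousAt (fun w : ℂ => Complex.Gamma (n + w + 1)) μ :=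
    ContinuousAt.comp' (Complex.differentiableAt_Gamma _ hpos).continuousAt hadd
  have hr1 : ContinuousAt (fun w : ℂ => rGamma (n - w + 1)) μ :=
    ContinuousAt.comp' (differentiable_rGamma _).continuousAt hsub
  unfold legendreUExpansion'
  simp only [div_eq_mul_inv (Complex.Gamma _)]
  refine (hψ.mul (hP n)).add (tendsto_finsetSum _ fun k _ => ?_)
  exact continuousAt_const.mul
    ((hP k).sub ((continuousAt_const.mul (hG1.mul hr1)).mul (hP' k)))

end

theorem mainTheorem1 (n : ℕ) :
    -- the derivative with respect to the order exists for every complex `μ`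
    (∀ μ : ℂ, ∀ z ∈ cutPlane,
      HasDerivAt (fun w : ℂ => assocLegendreP n w z)
        (1 / 2 * assocLegendreP n μ z * Complex.log ((z + 1) / (z - 1)) + legendreU n μ z) μ) ∧
    -- first expansion, wherever no Gamma or digamma function in a numerator has a pole
    (∀ μ : ℂ, (∀ m : ℕ, 1 ≤ m → μ ≠ m) → (∀ m : ℕ, n < m → μ ≠ -m) → ∀ z ∈ cutPlane,
      legendreU n μ z = legendreUExpansion n μ z) ∧
    -- second expansion, likewise; it includes the integer orders `-n ≤ μ ≤ n`
    (∀ μ : ℂ, (∀ m : ℕ, n < m → μ ≠ m) → (∀ m : ℕ, n < m → μ ≠ -m) → ∀ z ∈ cutPlane,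
      legendreU n μ z = legendreUExpansion' n μ z) ∧
    -- for every complex order both expansions hold with the right-hand side taken as a limit
    (∀ μ : ℂ, ∀ z ∈ cutPlane,
      Filter.Tendsto (fun w : ℂ => legendreUExpansion n w z) (𝓝[≠] μ) (𝓝 (legendreU n μ z)) ∧
      Filter.Tendsto (fun w : ℂ => legendreUExpansion' n w z) (𝓝[≠] μ) (𝓝 (legendreU n μ z))) ∧
    -- the inhomogeneous Legendre equation
    (∀ μ : ℂ,
      DifferentiableOn ℂ (assocLegendreP n μ) cutPlane ∧
      DifferentiableOn ℂ (legendreU n μ) cutPlane ∧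
      ∀ z ∈ cutPlane,
        legendreOp n μ (legendreU n μ) z =
          -2 * deriv (assocLegendreP n μ) z + 2 * μ / (1 - z ^ 2) * assocLegendreP n μ z) := by

  refine ⟨fun μ z hz => ?_, fun μ hμ hμ' z hz => ?_, fun μ hμ hμ' z hz => ?_, fun μ z hz =>
    ⟨tendsto_legendreUExpansion n μ hz, tendsto_legendreUExpansion' n μ hz⟩, fun μ =>
    ⟨fun z hz => ?_, fun z hz => ?_, fun z hz => ?_⟩⟩
  · rw [legendreU_eq n μ hz]
    exact hasDerivAt_assocLegendreP_order n μ hz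
  -- The expansion is continuous at `μ`, so its punctured limit, already known to be `U`, is also
  -- its value.
  · exact tendsto_nhds_unique (tendsto_legendreUExpansion n μ hz)
      ((continuousAt_legendreUExpansion n hμ hμ' hz).tendsto.mono_left nhdsWithin_le_nhds)
  · exact tendsto_nhds_unique (tendsto_legendreUExpansion' n μ hz)
      ((continuousAt_legendreUExpansion' n hμ hμ' hz).tendsto.mono_left nhdsWithin_le_nhds)
  · rw [funext (assocLegendreP_eq n μ)]
    exact (hasDerivAt_legendrePrefactor_mul_eval μ _ hz).differentiableAt.differentiableWithinAt
  · refine DifferentiableWithinAt.congr ?_ (fun w hw => legendreU_eq n μ hw) (legendreU_eq n μ hz)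
    exact (hasDerivAt_legendrePrefactor_mul_eval μ _ hz).differentiableAt.differentiableWithinAt
  · rw [legendreOp_prefactor_mul_eval n μ _ (fun w hw => legendreU_eq n μ hw) hz,
      legendrePolyOp_legendrePolyDeriv, funext (assocLegendreP_eq n μ),
      (hasDerivAt_legendrePrefactor_mul_eval μ _ hz).deriv]
    ring
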